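/- **Setting.** Let $d\ge 0$, $\Omega=\mathbb R^d$, $n\ge 1$, and $\mathcal H_0=\mathbb R^{p_0}$. For $k=1,\dots,n$ let $S_k\subset\mathbb R^d$ be compact with positive Lebesgue measure, $\nu_k$ the normalized uniform measure on $S_k$, $\sigma_k>0$ a pooling scale, and $\kappa_k(u)=\sum_{j\ge0}b_{k,j}u^j$ on $[-1,1]$ with $b_{k,j}\ge 0$, $\kappa_k(1)=\sum_j b_{k,j}=1$ and $\kappa_k'(1)=\sum_j j\,b_{k,j}=1$. Define recursively the Hilbert spaces $\mathcal P_k=L^2(S_k,\mathcal H_{k-1};\nu_k)$ and $\mathcal H_k$, the RKHS of the kernel on $\mathcal P_k$ $$K_k(z,z')=\|z\|\,\|z'\|\,\kappa_k\!\Big(\frac{\langle z,z'\rangle}{\|z\|\|z'\|}\Big)\quad(z,z'\neq0),\qquad K_k(z,z')=0\ \text{ otherwise},$$ with kernel mapping $\varphi_k(z)=K_k(z,\cdot)$. For $x_0\in L^2(\Omega,\mathcal H_0)$ put $x_k=A_kM_kP_kx_{k-1}\in L^2(\Omega,\mathcal H_k)$, where $P_kx(u)=(v\mapsto x(u+v))_{v\in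 S_k}\in\mathcal P_k$, $M_ky(u)=\varphi_k(y(u))$, and $A_ky(u)=\int_{\mathbb R^d}h_{\sigma_k}(u-v)\,y(v)\,dv$ with $h_s(u)=s^{-d}(2\pi)^{-d/2}e^{-|u/s|^2/2}$. Let $\mathcal H_{\mathcal K_n}$ be the RKHS of the kernel $\mathcal K_n(x_0,x_0')=\langle x_n,x_n'\rangle_{L^2(\Omega,\mathcal H_n)}$ on $L^2(\Omega,\mathcal H_0)$. **CNN.** Let $\sigma(u)=\sum_{j\ge0}a_ju^j$, where $a_j=0$ whenever $b_{k,j}=0$ for some $k\le n$, and for $k\le n$ put $$C_{\sigma,k}^2(t)=\sum_{j:\,b_{k,j}>0}\frac{a_j^2}{b_{k,j}}\,t^j,\qquad t\ge 0.$$ Assume $C_{\sigma,k}^2(t)<\infty$ for all $t\ge0$ and all $k\le n$ (so the series of $\sigma$ converges on all of $\mathbb R$, and $\sigma$ denotes its sum there). Given numbers of channels $p_1,\dots,p_n$, filters $w_k^i=(w_k^{ij})_{j\le p_{k-1}}\in L^2(S_k,\mathbb R^{p_{k-1}};\nu_k)$ for $1\le k\le n$, $1\le i\le p_k$, and $w_{n+1}=(w_{n+1}^i)_{i\le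 p_n}\in L^2(\Omega,\mathbb R^{p_n})$, define $z_0=x_0$, $z_k=A_k\tilde z_k$, $$\tilde z_k^i(u)=n_k(u)\,\sigma\big(\langle w_k^i,P_kz_{k-1}(u)\rangle/n_k(u)\big),\qquad n_k(u)=\|P_kx_{k-1}(u)\|$$ (with $\tilde z^i_k(u)=0$ where $n_k(u)=0$), and $f_\sigma(x_0)=\langle w_{n+1},z_n\rangle_{L^2(\Omega,\mathbb R^{p_n})}$. **Proposition (RKHS norm of CNNs).** For every $x_0$, the maps $\tilde z_k,z_k$ $(1\le k\le n)$ belong to $L^2(\Omega,\mathbb R^{p_k})$; the function $f_\sigma$ belongs to $\mathcal H_{\mathcal K_n}$, and $$\|f_\sigma\|_{\mathcal H_{\mathcal K_n}}^2\le p_n\sum_{i=1}^{p_n}\|w_{n+1}^i\|_2^2\,B_{n,i},$$ where $B_{1,i}=C_{\sigma,1}^2(\|w_1^i\|_2^2)$ and, for $2\le k\le n$, $$B_{k,i}=C_{\sigma,k}^2\Big(p_{k-1}\sum_{j=1}^{p_{k-1}}\|w_k^{ij}\|_2^2\,B_{k-1,j}\Big).$$ -/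

import Mathlib

open MeasureTheory
open scoped ENNReal InnerProductSpace

noncomputable section

namespace CKN

/-- Maclaurin coefficients of a dot-product kernel function `κ(u) = ∑ b_j u^j`: they are nonnegative,
`∑ b_j` and `∑ j b_j` converge, `κ(1) = ∑ b_j = 1` and `κ'(1) = ∑ j b_j = 1`. -/
structure Coeffs where
  b : ℕ → ℝ
  b_nonneg : ∀ j, 0 ≤ b j
  hasSum_b : HasSum b 1
  hasSum_deriv : HasSum (fun j : ℕ => (j : ℝ) * b j) 1

namespace Coeffs
/-- `κ(u) = ∑ b_j u^j`. -/
def kappa (c : Coeffs) (u : ℝ) : ℝ := ∑' j, c.b j * u ^ j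

theorem summable_kappa (c : Coeffs) {u : ℝ} (hu : |u| ≤ 1) :
    Summable (fun j => c.b j * u ^ j) := by
  refine Summable.of_norm_bounded c.hasSum_b.summable fun j => ?_
  rw [norm_mul, norm_pow, Real.norm_eq_abs, Real.norm_eq_abs, abs_of_nonneg (c.b_nonneg j)]
  exact mul_le_of_le_one_right (c.b_nonneg j) (pow_le_one₀ (abs_nonneg u) hu)

theorem kappa_one (c : Coeffs) : c.kappa 1 = 1 := by
  simpa [kappa] using c.hasSum_b.tsum_eq

theorem le_kappa (c : Coeffs) {u : ℝ} (hu : |u| ≤ 1) : u ≤ c.kappa u := by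
  have h1 : HasSum (fun j => c.b j + (j : ℝ) * c.b j * (u - 1)) (1 + 1 * (u - 1)) :=
    c.hasSum_b.add (c.hasSum_deriv.mul_right (u - 1))
  have h2 := hasSum_le (fun j => ?_) h1 (c.summable_kappa hu).hasSum
  · simpa [kappa] using h2
  · have h3 := one_add_mul_le_pow (a := u - 1) (by linarith [(abs_le.1 hu).1]) j
    have h4 := mul_le_mul_of_nonneg_left h3 (c.b_nonneg j)
    rw [add_sub_cancel] at h4
    linarith

end Coeffs

section Kernel

variable {X F : Type*} [NormedAddCommGroup F] [InnerProductSpace ℝ F]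

/-- A real-valued kernel, as an operator-valued kernel over the Hilbert space `ℝ`. -/
def kernelMatrix (k : X → X → ℝ) : Matrix X X (ℝ →L[ℝ] ℝ) :=
  Matrix.of fun x y => k x y • ContinuousLinearMap.id ℝ ℝ

theorem posSemidef_kernelMatrix {k : X → X → ℝ} (hk : (Matrix.of k).PosSemidef) :
    (kernelMatrix k).PosSemidef := by
  have hs : ∀ x y, k y x = k x y := fun x y => by simpa using hk.1.apply x y
  have h0 := (RKHS.posSemidef_tfae (K := kernelMatrix k)).out 0 2
  refine h0.2 ⟨?_, fun v => ?_⟩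
  · ext x y
    simp [kernelMatrix, hs x y, ContinuousLinearMap.star_eq_adjoint, ContinuousLinearMap.adjoint_id]
  · have h := hk.2 v
    simpa [kernelMatrix, mul_comm, mul_left_comm, hs] using h

/-- The homogeneous dot-product kernel `K(z, z') = ‖z‖ ‖z'‖ κ(⟪z, z'⟫ / (‖z‖ ‖z'‖))`; it vanishes when
`z = 0` or `z' = 0`. -/
def dotKernel (c : Coeffs) (z z' : F) : ℝ :=
  ‖z‖ * ‖z'‖ * c.kappa (⟪z, z'⟫_ℝ / (‖z‖ * ‖z'‖))

theorem posSemidef_inner (v : X → F) : (Matrix.of fun x y => ⟪v x, v y⟫_ℝ).PosSemidef := by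
  refine ⟨by ext x y; simp [real_inner_comm], fun c => ?_⟩
  have h : (0 : ℝ) ≤ ⟪c.sum fun x a => a • v x, c.sum fun x a => a • v x⟫_ℝ :=
    real_inner_self_nonneg
  rw [Finsupp.sum_inner] at h
  simpa [Finsupp.inner_sum, Finsupp.mul_sum, inner_smul_right, inner_smul_left, mul_assoc,
    mul_comm, mul_left_comm] using h

theorem posSemidef_inner_pow (v : X → F) (j : ℕ) :
    (Matrix.of fun x y => ⟪v x, v y⟫_ℝ ^ j).PosSemidef := by
  induction j with
  | zero => simpa using posSemidef_inner (fun _ : X => (1 : ℝ))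
  | succ j ih => simpa [pow_succ] using! ih.hadamard (posSemidef_inner v)

theorem abs_cos_le (z z' : F) : |⟪z, z'⟫_ℝ / (‖z‖ * ‖z'‖)| ≤ 1 :=
  abs_real_inner_div_norm_mul_norm_le_one z z'

theorem posSemidef_dotKernel (c : Coeffs) :
    (Matrix.of (dotKernel c : F → F → ℝ)).PosSemidef := by
  refine ⟨by ext x y; simp [dotKernel, real_inner_comm, mul_comm], fun w => ?_⟩
  have hS : HasSum (fun j => w.sum fun x a => w.sum fun y b =>
      star a * (‖x‖ * ‖y‖ * (c.b j * (⟪x, y⟫_ℝ / (‖x‖ * ‖y‖)) ^ j)) * b)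
      (w.sum fun x a => w.sum fun y b => star a * (Matrix.of (dotKernel c : F → F → ℝ)) x y * b) := by
    refine hasSum_sum fun x _ => hasSum_sum fun y _ => ?_
    exact (((c.summable_kappa (abs_cos_le x y)).hasSum.mul_left _).mul_left _).mul_right _
  refine hS.nonneg fun j => ?_
  have hj := (((posSemidef_inner (fun x : F => ‖x‖)).hadamard
    (posSemidef_inner_pow (fun x : F => ‖x‖⁻¹ • x) j)).smul (c.b_nonneg j)).2 w
  refine hj.trans_eq ?_
  refine Finsupp.sum_congr fun x _ => Finsupp.sum_congr fun y _ => ?_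
  simp [inner_smul_left, inner_smul_right, div_eq_mul_inv, mul_comm, mul_left_comm, mul_assoc]

instance (c : Coeffs) : Fact (kernelMatrix (dotKernel c : F → F → ℝ)).PosSemidef :=
  ⟨posSemidef_kernelMatrix (posSemidef_dotKernel c)⟩

/-- The RKHS of the homogeneous dot-product kernel on `F`. -/
abbrev dotRKHS (c : Coeffs) (F : Type*) [NormedAddCommGroup F] [InnerProductSpace ℝ F] : Type _ :=
  RKHS.OfKernel (kernelMatrix (dotKernel c : F → F → ℝ))

/-- The kernel mapping `φ(z) = K(z, ·)`. -/
def featureMap (c : Coeffs) (z : F) : dotRKHS c F :=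
  RKHS.kerFun (dotRKHS c F) z 1

theorem inner_featureMap (c : Coeffs) (z z' : F) :
    ⟪featureMap c z, featureMap c z'⟫_ℝ = dotKernel c z z' := by
  have h := RKHS.kernel_inner (dotRKHS c F) z' z (1 : ℝ) (1 : ℝ)
  rw [RKHS.OfKernel.kernel_ofKernel] at h
  rw [featureMap, featureMap, ← h]
  simp [kernelMatrix, dotKernel, real_inner_comm, mul_comm]

theorem dotKernel_self (c : Coeffs) (z : F) : dotKernel c z z = ‖z‖ ^ 2 := by
  by_cases hz : ‖z‖ = 0
  · simp [dotKernel, hz]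
  · rw [dotKernel, real_inner_self_eq_norm_mul_norm, div_self (mul_ne_zero hz hz), c.kappa_one]
    ring

theorem inner_le_dotKernel (c : Coeffs) (z z' : F) : ⟪z, z'⟫_ℝ ≤ dotKernel c z z' := by
  by_cases hz : ‖z‖ * ‖z'‖ = 0
  · have h := real_inner_le_norm z z'
    simpa [dotKernel, hz] using h
  · have h := mul_le_mul_of_nonneg_left (c.le_kappa (abs_cos_le z z'))
      (mul_nonneg (norm_nonneg z) (norm_nonneg z'))
    rwa [mul_div_cancel₀ _ hz] at h

theorem norm_featureMap (c : Coeffs) (z : F) : ‖featureMap c z‖ = ‖z‖ := by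
  have h := inner_featureMap c z z
  rw [dotKernel_self, real_inner_self_eq_norm_sq] at h
  exact (sq_eq_sq₀ (norm_nonneg _) (norm_nonneg _)).1 h

theorem featureMap_zero (c : Coeffs) : featureMap c (0 : F) = 0 := by
  rw [← norm_eq_zero, norm_featureMap, norm_zero]

theorem lipschitzWith_featureMap (c : Coeffs) :
    LipschitzWith 1 (featureMap c : F → dotRKHS c F) := by
  refine LipschitzWith.of_dist_le_mul fun z z' => ?_
  rw [dist_eq_norm, dist_eq_norm, NNReal.coe_one, one_mul,
    ← sq_le_sq₀ (norm_nonneg _) (norm_nonneg _), norm_sub_sq_real, norm_sub_sq_real,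
    norm_featureMap, norm_featureMap, inner_featureMap]
  linarith [inner_le_dotKernel c z z']

end Kernel

/-- The domain `Ω = ℝ^d`. -/
abbrev Dom (d : ℕ) : Type := EuclideanSpace ℝ (Fin d)

/-- A patch shape: a compact subset of `ℝ^d` of positive Lebesgue measure. -/
structure PatchShape (d : ℕ) where
  S : Set (Dom d)
  isCompact : IsCompact S
  volume_pos : 0 < volume S

/-- The normalized uniform measure on the patch. -/
def PatchShape.unif {d : ℕ} (p : PatchShape d) : Measure (Dom d) :=
  (volume p.S)⁻¹ • volume.restrict p.S

theorem PatchShape.unif_univ {d : ℕ} (p : PatchShape d) : p.unif Set.univ = 1 := by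
  simp [PatchShape.unif, ENNReal.inv_mul_cancel p.volume_pos.ne' p.isCompact.measure_lt_top.ne]

instance {d : ℕ} (p : PatchShape d) : IsProbabilityMeasure p.unif := ⟨p.unif_univ⟩

theorem PatchShape.inv_volume_ne_top {d : ℕ} (p : PatchShape d) : (volume p.S)⁻¹ ≠ ∞ :=
  ENNReal.inv_ne_top.2 p.volume_pos.ne'

theorem PatchShape.unif_le {d : ℕ} (p : PatchShape d) : p.unif ≤ (volume p.S)⁻¹ • volume :=
  Measure.le_intro fun s _ _ => by
    simp only [PatchShape.unif, Measure.smul_apply, smul_eq_mul]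
    exact mul_le_mul_right (Measure.restrict_apply_le _ _) _

/-- Signals: `L²(ℝ^d, F)`. -/
abbrev Signal (d : ℕ) (F : Type*) [NormedAddCommGroup F] : Type _ :=
  Lp F 2 (volume : Measure (Dom d))

/-- Patches: `L²(S, F)` with the normalized uniform measure on `S`. -/
abbrev Patch {d : ℕ} (p : PatchShape d) (F : Type*) [NormedAddCommGroup F] : Type _ :=
  Lp F 2 p.unif

section Operators

variable {d : ℕ} {F : Type*} [NormedAddCommGroup F]

theorem memLp_patch (p : PatchShape d) (x : Signal d F) (u : Dom d) :
    MemLp (fun v => x (u + v)) 2 p.unif :=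
  ((Lp.memLp x).comp_measurePreserving
    (measurePreserving_add_left volume u)).of_measure_le_smul p.inv_volume_ne_top p.unif_le

/-- The patch of `x` at `u`: `v ↦ x(u + v)`. -/
def patch (p : PatchShape d) (x : Signal d F) (u : Dom d) :
    Patch p F :=
  (memLp_patch p x u).toLp

variable [NormedSpace ℝ F]

theorem continuous_patch (p : PatchShape d) (x : Signal d F) :
    Continuous (patch p x) := by
  have : Fact ((2 : ℝ≥0∞) ≠ ∞) := ⟨ENNReal.ofNat_ne_top⟩
  have h0 : Continuous (DomAddAct.mk : Dom d → (Dom d)ᵈᵃᵃ) := DomAddAct.continuous_mk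
  have h1 : Continuous fun u : Dom d =>
      (DomAddAct.mk u +ᵥ x : Signal d F) :=
    h0.vadd continuous_const
  have h2 := (Lp.LpToLpOfMeasureLeSMul (E := F) (p := 2) p.inv_volume_ne_top
    p.unif_le).continuous.comp h1
  convert! h2 using 1
  funext u
  refine Lp.ext ?_
  refine (memLp_patch p x u).coeFn_toLp.trans (Filter.EventuallyEq.symm ?_)
  refine (Lp.coeFn_LpToLpOfMeasureLeSMul _ _ _).trans ?_
  exact (Measure.absolutelyContinuous_of_le_smul p.unif_le).ae_eq (DomAddAct.vadd_Lp_ae_eq _ x)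

theorem memLp_patch_volume (p : PatchShape d) (x : Signal d F) :
    MemLp (patch p x) 2 volume := by
  refine ⟨(continuous_patch p x).aestronglyMeasurable, ?_⟩
  have hx := (Lp.memLp x).2
  rw [eLpNorm_lt_top_iff_lintegral_rpow_enorm_lt_top two_ne_zero ENNReal.ofNat_ne_top] at hx ⊢
  have hm : Measurable fun q : Dom d × Dom d => ‖x (q.1 + q.2)‖ₑ ^ (2 : ℝ≥0∞).toReal :=
    ((Lp.stronglyMeasurable x).enorm.comp (measurable_fst.add measurable_snd)).pow_const _
  have he : ∀ u, ‖patch p x u‖ₑ ^ (2 : ℝ≥0∞).toReal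
      = ∫⁻ v, ‖x (u + v)‖ₑ ^ (2 : ℝ≥0∞).toReal ∂p.unif := fun u => by
    rw [patch, Lp.enorm_toLp, eLpNorm_eq_lintegral_rpow_enorm_toReal two_ne_zero
      ENNReal.ofNat_ne_top, ← ENNReal.rpow_mul]
    simp
  simp_rw [he]
  rw [lintegral_lintegral_swap hm.aemeasurable]
  have ht : ∀ v : Dom d, ∫⁻ u : Dom d, ‖x (u + v)‖ₑ ^ (2 : ℝ≥0∞).toReal
      = ∫⁻ u : Dom d, ‖x u‖ₑ ^ (2 : ℝ≥0∞).toReal := fun v =>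
    lintegral_add_right_eq_self (fun u => ‖x u‖ₑ ^ (2 : ℝ≥0∞).toReal) v
  rw [lintegral_congr ht]
  simpa using hx

/-- The patch extraction operator `P`. -/
def patchOp (p : PatchShape d) (x : Signal d F) :
    Signal d (Patch p F) :=
  (memLp_patch_volume p x).toLp

/-- The Gaussian filter `h_s(u) = s^{-d} h(u / s)`, `h(u) = (2π)^{-d/2} exp(-|u|² / 2)`. -/
def gauss (d : ℕ) (s : ℝ) (u : Dom d) : ℝ :=
  (s ^ d)⁻¹ * ((2 * Real.pi) ^ (-(d : ℝ) / 2) * Real.exp (-‖s⁻¹ • u‖ ^ 2 / 2))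

theorem continuous_gauss (s : ℝ) : Continuous (gauss d s) := by
  unfold gauss
  fun_prop

theorem integrable_gauss {s : ℝ} (hs : 0 < s) : Integrable (gauss d s) := by
  have h := (GaussianFourier.integrable_cexp_neg_mul_sq_norm_add (V := Dom d) (b := 1 / 2)
    (by norm_num) 0 0).re
  have h2 := ((h.comp_smul (inv_ne_zero hs.ne')).const_mul
    ((2 * Real.pi) ^ (-(d : ℝ) / 2))).const_mul (s ^ d)⁻¹
  refine h2.congr (Filter.Eventually.of_forall fun u => ?_)
  have h3 : (-(1 / 2 : ℂ) * (‖s⁻¹ • u‖ : ℂ) ^ 2 + 0 * (⟪(0 : Dom d), s⁻¹ • u⟫_ℝ : ℂ))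
      = ((-‖s⁻¹ • u‖ ^ 2 / 2 : ℝ) : ℂ) := by
    push_cast
    ring
  simp only [gauss]
  rw [h3, ← Complex.ofReal_exp]
  rfl

/-- Gaussian pooling of a function, `u ↦ ∫ h_s(u - v) y(v) dv`. -/
def pool (s : ℝ) (y : Dom d → F) (u : Dom d) : F :=
  ∫ v, gauss d s (u - v) • y v

theorem memLp_pool {s : ℝ} (hs : 0 < s) (y : Signal d F) :
    MemLp (pool s y) 2 volume := by
  have hym := Lp.stronglyMeasurable y
  have hy := (Lp.memLp y).2
  constructor
  · refine StronglyMeasurable.aestronglyMeasurable ?_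
    refine StronglyMeasurable.integral_prod_right (ν := (volume : Measure (Dom d)))
      (f := fun u v => gauss d s (u - v) • y v) ?_
    exact ((continuous_gauss s).comp continuous_sub).stronglyMeasurable.smul
      (hym.comp_measurable measurable_snd)
  rw [eLpNorm_lt_top_iff_lintegral_rpow_enorm_lt_top two_ne_zero ENNReal.ofNat_ne_top] at hy ⊢
  have h2 : (2 : ℝ≥0∞).toReal = 2 := by simp
  rw [h2] at hy ⊢
  set G : ℝ≥0∞ := ∫⁻ v, ‖gauss d s v‖ₑ with hG
  have hGfin : G < ∞ := (integrable_gauss hs).2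
  have hmg : Measurable fun v => ‖gauss d s v‖ₑ := (continuous_gauss s).measurable.enorm
  have hb : ∀ u, ‖pool s y u‖ₑ ^ (2 : ℝ)
      ≤ G * ∫⁻ v, ‖gauss d s (u - v)‖ₑ * ‖y v‖ₑ ^ (2 : ℝ) := fun u => by
    have hgu : Measurable fun v => ‖gauss d s (u - v)‖ₑ :=
      hmg.comp (measurable_const.sub measurable_id)
    have h1 : ‖pool s y u‖ₑ ≤ ∫⁻ v, ‖gauss d s (u - v)‖ₑ ^ (1 / 2 : ℝ)
        * (‖gauss d s (u - v)‖ₑ * ‖y v‖ₑ ^ (2 : ℝ)) ^ (1 / 2 : ℝ) := by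
      refine (enorm_integral_le_lintegral_enorm _).trans_eq (lintegral_congr fun v => ?_)
      rw [enorm_smul, ENNReal.mul_rpow_of_nonneg _ _ (by norm_num), ← mul_assoc,
        ← ENNReal.rpow_add_of_nonneg _ _ (by norm_num) (by norm_num), ← ENNReal.rpow_mul]
      norm_num
    have h3 := h1.trans (ENNReal.lintegral_mul_norm_pow_le hgu.aemeasurable
      (hgu.mul (hym.enorm.pow_const 2)).aemeasurable (by norm_num) (by norm_num) (by norm_num))
    have h4 := ENNReal.rpow_le_rpow h3 (z := 2) (by norm_num)
    rw [ENNReal.mul_rpow_of_nonneg _ _ (by norm_num), ← ENNReal.rpow_mul,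
      ← ENNReal.rpow_mul] at h4
    rw [lintegral_sub_left_eq_self (fun v => ‖gauss d s v‖ₑ) u] at h4
    simpa [hG] using h4
  refine (lintegral_mono hb).trans_lt ?_
  have hm : Measurable fun q : Dom d × Dom d =>
      ‖gauss d s (q.1 - q.2)‖ₑ * ‖y q.2‖ₑ ^ (2 : ℝ) :=
    (hmg.comp (measurable_fst.sub measurable_snd)).mul
      ((hym.enorm.comp measurable_snd).pow_const _)
  rw [lintegral_const_mul _ hm.lintegral_prod_right', lintegral_lintegral_swap hm.aemeasurable]
  refine ENNReal.mul_lt_top hGfin ?_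
  have hi : ∀ v, ∫⁻ u, ‖gauss d s (u - v)‖ₑ * ‖y v‖ₑ ^ (2 : ℝ) = G * ‖y v‖ₑ ^ (2 : ℝ) := fun v => by
    have hgv : Measurable fun u => ‖gauss d s (u - v)‖ₑ :=
      hmg.comp (measurable_id.sub measurable_const)
    rw [lintegral_mul_const _ hgv, lintegral_sub_right_eq_self (fun u => ‖gauss d s u‖ₑ) v]
  simp_rw [hi]
  rw [lintegral_const_mul _ (hym.enorm.pow_const _)]
  exact ENNReal.mul_lt_top hGfin hy

/-- The pooling operator `A` on `L²(ℝ^d, F)`. -/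
def poolOp {s : ℝ} (hs : 0 < s) (y : Signal d F) :
    Signal d F :=
  (memLp_pool hs y).toLp

end Operators

section Network

/-- The kernel mapping operator `M`: the kernel mapping applied pointwise. -/
def kernelOp {d : ℕ} {F : Type*} [NormedAddCommGroup F] [InnerProductSpace ℝ F] (c : Coeffs)
    (y : Signal d F) : Signal d (dotRKHS c F) :=
  (lipschitzWith_featureMap c).compLp (featureMap_zero c) y

/-- The data of one layer: patch shape, pooling scale and dot-product kernel. -/
structure Layer (d : ℕ) where
  shape : PatchShape d
  scale : ℝ
  scale_pos : 0 < scale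
  coeffs : Coeffs

/-- A bundled real Hilbert space. -/
structure HilbertType where
  carrier : Type
  [normed : NormedAddCommGroup carrier]
  [inner : InnerProductSpace ℝ carrier]
  [complete : CompleteSpace carrier]

instance : CoeSort HilbertType Type := ⟨HilbertType.carrier⟩

attribute [instance] HilbertType.normed HilbertType.inner HilbertType.complete

/-- One layer of the kernel representation, `x ↦ A M P x`. -/
def layerOp {d : ℕ} (l : Layer d) {F : Type*} [NormedAddCommGroup F] [InnerProductSpace ℝ F]
    (x : Signal d F) : Signal d (dotRKHS l.coeffs (Patch l.shape F)) :=
  poolOp l.scale_pos (kernelOp l.coeffs (patchOp l.shape x))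

/-- The Hilbert spaces: `H_0 = ℝ^{p₀}`, and `H_{k+1}` is the RKHS of the dot-product kernel on
`L²(S_{k+1}, H_k)`. The entry `L k` is the `(k+1)`-st layer. -/
def featureSpace {d : ℕ} (L : ℕ → Layer d) (p₀ : ℕ) : ℕ → HilbertType
  | 0 => ⟨EuclideanSpace ℝ (Fin p₀)⟩
  | k + 1 => ⟨dotRKHS (L k).coeffs (Patch (L k).shape (featureSpace L p₀ k))⟩

/-- The kernel representation: `x_0` is the input and `x_{k+1} = A_{k+1} M_{k+1} P_{k+1} x_k`. -/
def feature {d : ℕ} (L : ℕ → Layer d) {p₀ : ℕ} (x₀ : Signal d (EuclideanSpace ℝ (Fin p₀))) :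
    ∀ k, Signal d (featureSpace L p₀ k)
  | 0 => x₀
  | k + 1 => layerOp (L k) (feature L x₀ k)

/-- The kernel `𝒦_n(x₀, x₀') = ⟪x_n, x_n'⟫`. -/
def finalKernel {d : ℕ} (L : ℕ → Layer d) (p₀ n : ℕ)
    (x₀ x₀' : Signal d (EuclideanSpace ℝ (Fin p₀))) : ℝ :=
  ⟪feature L x₀ n, feature L x₀' n⟫_ℝ

instance {d : ℕ} (L : ℕ → Layer d) (p₀ n : ℕ) :
    Fact (kernelMatrix (finalKernel L p₀ n)).PosSemidef :=
  ⟨posSemidef_kernelMatrix (posSemidef_inner fun x₀ => feature L x₀ n)⟩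

/-- The RKHS of `𝒦_n`. -/
abbrev finalRKHS {d : ℕ} (L : ℕ → Layer d) (p₀ n : ℕ) : Type :=
  RKHS.OfKernel (kernelMatrix (finalKernel L p₀ n))

/-- The filters of a CNN with `p k` channels at level `k`: `w k i` is the `i`-th filter of the
`(k+1)`-st layer, an element of `L²(S_{k+1}, ℝ^{p_k})`. -/
abbrev Filters {d : ℕ} (L : ℕ → Layer d) (p : ℕ → ℕ) : Type :=
  ∀ k, Fin (p (k + 1)) → Patch (L k).shape (EuclideanSpace ℝ (Fin (p k)))

/-- Filtering followed by the homogenized activation: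
`u ↦ (nrm(u) σ(⟪w^i, z(u + ·)⟫ / nrm(u)))_i`. -/
def convAct {d m q : ℕ} (σ : ℝ → ℝ) (S : PatchShape d)
    (w : Fin q → Patch S (EuclideanSpace ℝ (Fin m))) (nrm : Dom d → ℝ)
    (z : Dom d → EuclideanSpace ℝ (Fin m)) (u : Dom d) : EuclideanSpace ℝ (Fin q) :=
  WithLp.toLp 2 fun i => nrm u * σ ((∫ v, ⟪w i v, z (u + v)⟫_ℝ ∂S.unif) / nrm u)

/-- The intermediate map `z̃_{k+1}` computed from `z = z_k`, with `n_{k+1}(u) = ‖P_{k+1} x_k(u)‖`. -/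
def cnnStep {d : ℕ} (L : ℕ → Layer d) {p : ℕ → ℕ} (σ : ℝ → ℝ) (w : Filters L p)
    (x₀ : Signal d (EuclideanSpace ℝ (Fin (p 0)))) (k : ℕ)
    (z : Dom d → EuclideanSpace ℝ (Fin (p k))) : Dom d → EuclideanSpace ℝ (Fin (p (k + 1))) :=
  convAct σ (L k).shape (w k) (fun u => ‖patch (L k).shape (feature L x₀ k) u‖) z

/-- The CNN maps: `z_0 = x_0` and `z_{k+1} = A_{k+1} z̃_{k+1}`. -/
def cnnMap {d : ℕ} (L : ℕ → Layer d) {p : ℕ → ℕ} (σ : ℝ → ℝ) (w : Filters L p)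
    (x₀ : Signal d (EuclideanSpace ℝ (Fin (p 0)))) :
    ∀ k, Dom d → EuclideanSpace ℝ (Fin (p k))
  | 0 => x₀
  | k + 1 => pool (L k).scale (cnnStep L σ w x₀ k (cnnMap L σ w x₀ k))

/-- The CNN prediction function `f_σ(x₀) = ⟪w_{n+1}, z_n⟫` in `L²(ℝ^d, ℝ^{p_n})`. -/
def cnn {d : ℕ} (L : ℕ → Layer d) {p : ℕ → ℕ} (σ : ℝ → ℝ) (w : Filters L p) (n : ℕ)
    (wOut : Signal d (EuclideanSpace ℝ (Fin (p n))))
    (x₀ : Signal d (EuclideanSpace ℝ (Fin (p 0)))) : ℝ :=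
  ∫ u, ⟪wOut u, cnnMap L σ w x₀ n u⟫_ℝ

/-- `C_σ²(t) = ∑ (a_j² / b_j) t^j`; terms with `a_j = b_j = 0` vanish. -/
def actC (a : ℕ → ℝ) (c : Coeffs) (t : ℝ) : ℝ := ∑' j, a j ^ 2 / c.b j * t ^ j

/-- The `j`-th channel of an `L²` map with values in `ℝ^m`. -/
def channel {d m : ℕ} {μ : Measure (Dom d)} (w : Lp (EuclideanSpace ℝ (Fin m)) 2 μ) (j : Fin m) :
    Lp ℝ 2 μ :=
  (EuclideanSpace.proj j : EuclideanSpace ℝ (Fin m) →L[ℝ] ℝ).compLp w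

/-- The quantities `B_{k,i}`, `k ≥ 1` (the value at `k = 0` is a placeholder). -/
def bound {d : ℕ} (L : ℕ → Layer d) {p : ℕ → ℕ} (a : ℕ → ℝ) (w : Filters L p) :
    ∀ k, Fin (p k) → ℝ
  | 0 => fun _ => 0
  | 1 => fun i => actC a (L 0).coeffs (‖w 0 i‖ ^ 2)
  | k + 2 => fun i => actC a (L (k + 1)).coeffs
      (p (k + 1) * ∑ j, ‖channel (w (k + 1) i) j‖ ^ 2 * bound L a w (k + 1) j)

end Network

end CKN

end

/-!
The CNN is a linear functional of the kernel representation, layer by layer. By induction on `k`,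
every channel of the CNN map satisfies `z_k^i(u) = ⟪g_k^i, x_k(u)⟫` for almost every `u`, with
`g_k^i ∈ H_k` independent of the input and `‖g_k^i‖² ≤ B_{k,i}` (`CKN.exists_cnnMap_eq_inner`).

* Substituting `z_k^j = ⟪g_k^j, x_k⟫`, the pairing of a filter `w` with a patch of `z_k` becomes the
  pairing of `W = ∑ j, w^j g_k^j` with the patch of `x_k` (`CKN.integral_inner_eq_inner_mix`), and
  `‖W‖² ≤ p_k ∑ j, ‖w^j‖² ‖g_k^j‖²` by the triangle and Cauchy-Schwarz inequalities
  (`CKN.norm_mix_sq_le`).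
* The function `z ↦ ‖z‖ σ(⟪W, z⟫ / ‖z‖)` lies in the RKHS of the dot-product kernel with squared
  norm at most `C_σ²(‖W‖²)` (`CKN.exists_inner_featureMap_eq_activation`). Indeed, with `ψ_j x` in
  the role of the `j`-th tensor power of `x`, the kernel has the explicit feature map
  `Φ z = (√b_j ‖z‖ ψ_j(z / ‖z‖))_j`, and the function is `⟪V, Φ z⟫` for `V = (a_j / √b_j ψ_j W)_j`,
  whose squared norm is `C_σ²(‖W‖²)`.
* Pooling is a convergent integral at every point, so it commutes with the continuous functional
  `⟪g, ·⟫` (`CKN.memLp_and_pool_eq_inner_layerOp`).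

Both for the last step, from `x_n` to the RKHS of `𝒦_n`, and for the change of feature map above, the
tool is `CKN.exists_inner_eq_of_gram_eq`: two feature maps of the same kernel define the same
functions, with the same control of the norm.
-/

namespace CKN

/-! ### Transporting functions between feature spaces -/

/-- If two maps `Φ`, `φ` into inner product spaces have the same Gram matrix, every function
`x ↦ ⟪V, Φ x⟫` is also of the form `x ↦ ⟪g, φ x⟫`, with `‖g‖ ≤ ‖V‖`: `φ x ↦ Φ x` extends to a linear
isometry on the span of the `φ x`, and `g` represents the functional it induces. -/
theorem exists_inner_eq_of_gram_eq {X H H' : Type*} [NormedAddCommGroup H] [InnerProductSpace ℝ H]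
    [CompleteSpace H] [NormedAddCommGroup H'] [InnerProductSpace ℝ H'] (φ : X → H) (Φ : X → H')
    (h : ∀ x y, ⟪Φ x, Φ y⟫_ℝ = ⟪φ x, φ y⟫_ℝ) (V : H') :
    ∃ g : H, ‖g‖ ≤ ‖V‖ ∧ ∀ x, ⟪g, φ x⟫_ℝ = ⟪V, Φ x⟫_ℝ := by
  set T := Finsupp.linearCombination ℝ φ with hT
  set T' := Finsupp.linearCombination ℝ Φ with hT'
  have hnorm : ∀ c, ‖T' c‖ = ‖T c‖ := fun c => by
    have h1 : ⟪T' c, T' c⟫_ℝ = ⟪T c, T c⟫_ℝ := by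
      simp only [hT, hT', Finsupp.linearCombination_apply, Finsupp.sum_inner, Finsupp.inner_sum,
        inner_smul_left, inner_smul_right, h]
    rw [real_inner_self_eq_norm_sq, real_inner_self_eq_norm_sq] at h1
    exact (sq_eq_sq₀ (norm_nonneg _) (norm_nonneg _)).1 h1
  obtain ⟨s, hs⟩ := T.rangeRestrict.exists_rightInverse_of_surjective T.range_rangeRestrict
  have hTs : ∀ y, T (s y) = y := fun y => congrArg Subtype.val (LinearMap.congr_fun hs y)
  let ℓ : StrongDual ℝ (LinearMap.range T) :=
    LinearMap.mkContinuous ((innerₛₗ ℝ V).comp (T'.comp s)) ‖V‖ fun y => by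
      have h1 := norm_inner_le_norm (𝕜 := ℝ) V (T' (s y))
      rw [hnorm, hTs] at h1
      simpa using h1
  obtain ⟨ℓ', hℓ', hn⟩ := exists_extension_norm_eq _ ℓ
  refine ⟨(InnerProductSpace.toDual ℝ H).symm ℓ', ?_, fun x => ?_⟩
  · rw [LinearIsometryEquiv.norm_map, hn]
    exact LinearMap.mkContinuous_norm_le _ (norm_nonneg _) _
  · have hx : T (Finsupp.single x 1) = φ x := by simp [hT]
    have h1 : T' (s ⟨φ x, ⟨_, hx⟩⟩) = Φ x := by
      have h2 : T' (s ⟨φ x, ⟨_, hx⟩⟩ - Finsupp.single x 1) = 0 := by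
        rw [← norm_eq_zero, hnorm, map_sub, hTs, hx, sub_self, norm_zero]
      rw [map_sub, sub_eq_zero] at h2
      rw [h2]
      simp [hT']
    rw [InnerProductSpace.toDual_symm_apply, hℓ' ⟨φ x, ⟨_, hx⟩⟩]
    simp [ℓ, h1]

/-- The Gram matrix of the kernel functions of the RKHS of a real kernel. -/
theorem inner_kerFun_one {X : Type*} (k : X → X → ℝ) [Fact (kernelMatrix k).PosSemidef] (x y : X) :
    ⟪RKHS.kerFun (RKHS.OfKernel (kernelMatrix k)) x (1 : ℝ),
      RKHS.kerFun (RKHS.OfKernel (kernelMatrix k)) y (1 : ℝ)⟫_ℝ = k y x := by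
  rw [← RKHS.kernel_inner, RKHS.OfKernel.kernel_ofKernel]
  simp [kernelMatrix]

/-! ### Activations of linear functionals as elements of the RKHS -/

section Activation

variable {F : Type*} [NormedAddCommGroup F] [InnerProductSpace ℝ F]

theorem hasSum_dotKernel (c : Coeffs) (z z' : F) :
    HasSum (fun j => √(c.b j) * ‖z‖ * (√(c.b j) * ‖z'‖) * ⟪‖z‖⁻¹ • z, ‖z'‖⁻¹ • z'⟫_ℝ ^ j)
      (dotKernel c z z') := by
  have h := (c.summable_kappa (abs_cos_le z z')).hasSum.mul_left (‖z‖ * ‖z'‖)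
  refine h.congr_fun fun j => ?_
  have hb := Real.mul_self_sqrt (c.b_nonneg j)
  have hi : ⟪‖z‖⁻¹ • z, ‖z'‖⁻¹ • z'⟫_ℝ = ⟪z, z'⟫_ℝ / (‖z‖ * ‖z'‖) := by
    rw [inner_smul_left, inner_smul_right, div_eq_mul_inv, mul_inv]
    simp only [conj_trivial]
    ring
  rw [hi]
  linear_combination (‖z‖ * ‖z'‖ * (⟪z, z'⟫_ℝ / (‖z‖ * ‖z'‖)) ^ j) * hb

/-- `actC` is nondecreasing on `[0, ∞)`. -/
theorem actC_mono {a : ℕ → ℝ} {c : Coeffs}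
    (hC : ∀ t : ℝ, 0 ≤ t → Summable fun j => a j ^ 2 / c.b j * t ^ j) {s t : ℝ} (hs : 0 ≤ s)
    (hst : s ≤ t) : actC a c s ≤ actC a c t :=
  (hC s hs).tsum_le_tsum (fun j => mul_le_mul_of_nonneg_left (pow_le_pow_left₀ hs hst j)
    (div_nonneg (sq_nonneg _) (c.b_nonneg j))) (hC t (hs.trans hst))

/-- The homogenized activation `z ↦ ‖z‖ σ(⟪W, z⟫ / ‖z‖)`, with value `0` at `z = 0`, belongs to the
RKHS of the dot-product kernel, with squared norm at most `C_σ²(‖W‖²)`. -/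
theorem exists_inner_featureMap_eq_activation (c : Coeffs) {σ : ℝ → ℝ} {a : ℕ → ℝ}
    (hσ : ∀ u : ℝ, HasSum (fun j => a j * u ^ j) (σ u)) (hab : ∀ j, c.b j = 0 → a j = 0)
    (hC : ∀ t : ℝ, 0 ≤ t → Summable fun j => a j ^ 2 / c.b j * t ^ j) (W : F) :
    ∃ g : dotRKHS c F, ‖g‖ ^ 2 ≤ actC a c (‖W‖ ^ 2) ∧
      ∀ z, ⟪g, featureMap c z⟫_ℝ = ‖z‖ * σ (⟪W, z⟫_ℝ / ‖z‖) := by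
  -- The feature space used is the Hilbert sum over `j` of the RKHS of `⟪x, y⟫ ^ j`, whose kernel
  -- functions `ψ j x` play the role of the tensor powers of `x`.
  let k : ℕ → F → F → ℝ := fun j x y => ⟪x, y⟫_ℝ ^ j
  have (j : ℕ) : Fact (kernelMatrix (k j)).PosSemidef :=
    ⟨posSemidef_kernelMatrix (posSemidef_inner_pow id j)⟩
  let E : ℕ → Type _ := fun j => RKHS.OfKernel (kernelMatrix (k j))
  let ψ : ∀ j, F → E j := fun j x => RKHS.kerFun (E j) x (1 : ℝ)
  have hψ : ∀ j x y, ⟪ψ j x, ψ j y⟫_ℝ = ⟪x, y⟫_ℝ ^ j := fun j x y => by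
    rw [real_inner_comm]
    exact inner_kerFun_one (k j) y x
  have hψn : ∀ j x, ‖ψ j x‖ ^ 2 = (‖x‖ ^ 2) ^ j := fun j x => by
    rw [← real_inner_self_eq_norm_sq, hψ, real_inner_self_eq_norm_sq]
  have hmem : ∀ f : ∀ j, E j, (Summable fun j => ‖f j‖ ^ 2) → Memℓp f 2 := fun f hf =>
    memℓp_gen (by simpa using hf)
  have hΦ : ∀ z, Memℓp (fun j => (√(c.b j) * ‖z‖) • ψ j (‖z‖⁻¹ • z)) 2 := fun z => by
    refine hmem _ ((hasSum_dotKernel c z z).summable.congr fun j => ?_)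
    rw [norm_smul, mul_pow, hψn, real_inner_self_eq_norm_sq, Real.norm_eq_abs, sq_abs]
    ring
  have hVn : ∀ j, ‖(a j / √(c.b j)) • ψ j W‖ ^ 2 = a j ^ 2 / c.b j * (‖W‖ ^ 2) ^ j := fun j => by
    rw [norm_smul, mul_pow, hψn, Real.norm_eq_abs, sq_abs, div_pow, Real.sq_sqrt (c.b_nonneg j)]
  have hV : Memℓp (fun j => (a j / √(c.b j)) • ψ j W) 2 :=
    hmem _ ((hC _ (sq_nonneg _)).congr fun j => (hVn j).symm)
  let V : lp E 2 := ⟨_, hV⟩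
  let Φ : F → lp E 2 := fun z => ⟨_, hΦ z⟩
  obtain ⟨g, hg, hgz⟩ := exists_inner_eq_of_gram_eq (featureMap c) Φ (fun x y => by
    rw [inner_featureMap]
    refine (lp.hasSum_inner (𝕜 := ℝ) (Φ x) (Φ y)).unique ?_
    refine (hasSum_dotKernel c x y).congr_fun fun j => ?_
    simp only [Φ, inner_smul_left, inner_smul_right, hψ, conj_trivial]
    ring) V
  refine ⟨g, ?_, fun z => ?_⟩
  · have h2 : ‖V‖ ^ 2 = actC a c (‖W‖ ^ 2) := by
      have h3 := lp.norm_rpow_eq_tsum (p := 2) (by simp) V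
      simp only [ENNReal.toReal_ofNat, Real.rpow_ofNat] at h3
      rw [h3, actC]
      exact tsum_congr hVn
    rw [← h2]
    exact pow_le_pow_left₀ (norm_nonneg _) hg 2
  · rw [hgz]
    refine (lp.hasSum_inner (𝕜 := ℝ) V (Φ z)).unique ?_
    refine ((hσ _).mul_left ‖z‖).congr_fun fun j => ?_
    simp only [V, Φ, inner_smul_left, inner_smul_right, hψ, conj_trivial]
    have hi : ‖z‖⁻¹ * ⟪W, z⟫_ℝ = ⟪W, z⟫_ℝ / ‖z‖ := by ring
    rw [hi]
    by_cases hb : c.b j = 0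
    · simp [hab j hb]
    · have hs : √(c.b j) ≠ 0 := (Real.sqrt_ne_zero (c.b_nonneg j)).2 hb
      field_simp

end Activation

/-! ### Mixing channels -/

section Mix

variable {d m : ℕ} {μ : Measure (Dom d)} {H : Type*} [NormedAddCommGroup H]
  [InnerProductSpace ℝ H]

/-- The `H`-valued map `v ↦ ∑ j, w^j(v) g_j` obtained from an `ℝ^m`-valued map `w`. -/
noncomputable def mix (w : Lp (EuclideanSpace ℝ (Fin m)) 2 μ) (g : Fin m → H) : Lp H 2 μ :=
  ∑ j, (ContinuousLinearMap.toSpanSingleton ℝ (g j)).compLp (channel w j)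

theorem norm_mix_sq_le (w : Lp (EuclideanSpace ℝ (Fin m)) 2 μ) (g : Fin m → H) :
    ‖mix w g‖ ^ 2 ≤ m * ∑ j, ‖channel w j‖ ^ 2 * ‖g j‖ ^ 2 := by
  have h1 : ‖mix w g‖ ≤ ∑ j, ‖channel w j‖ * ‖g j‖ :=
    (norm_sum_le _ _).trans (Finset.sum_le_sum fun j _ => by
      refine (ContinuousLinearMap.norm_compLp_le _ _).trans_eq ?_
      rw [ContinuousLinearMap.norm_toSpanSingleton, mul_comm])
  refine (pow_le_pow_left₀ (norm_nonneg _) h1 2).trans ?_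
  simpa [mul_pow] using
    sq_sum_le_card_mul_sum_sq (s := Finset.univ) (f := fun j => ‖channel w j‖ * ‖g j‖)

theorem coeFn_mix (w : Lp (EuclideanSpace ℝ (Fin m)) 2 μ) (g : Fin m → H) :
    ∀ᵐ v ∂μ, mix w g v = ∑ j, w v j • g j := by
  have h1 : ∀ᵐ v ∂μ, ∀ j, (ContinuousLinearMap.toSpanSingleton ℝ (g j)).compLp (channel w j) v
      = w v j • g j := ae_all_iff.2 fun j => by
    filter_upwards [(ContinuousLinearMap.toSpanSingleton ℝ (g j)).coeFn_compLp (channel w j),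
      (EuclideanSpace.proj j : EuclideanSpace ℝ (Fin m) →L[ℝ] ℝ).coeFn_compLp w] with v h2 h3
    rw [h2, channel, h3]
    simp
  filter_upwards [h1, Lp.coeFn_finsetSum Finset.univ fun j =>
    (ContinuousLinearMap.toSpanSingleton ℝ (g j)).compLp (channel w j)] with v h2 h3
  rw [mix, h3, Finset.sum_apply]
  exact Finset.sum_congr rfl fun j _ => h2 j

/-- When the channels of `z` are `⟪g_j, y⟫`, pairing `w` with `z` is pairing `mix w g` with `y`. -/
theorem integral_inner_eq_inner_mix (w : Lp (EuclideanSpace ℝ (Fin m)) 2 μ) (g : Fin m → H)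
    (y : Lp H 2 μ) (z : Dom d → EuclideanSpace ℝ (Fin m))
    (hz : ∀ᵐ v ∂μ, ∀ j, z v j = ⟪g j, y v⟫_ℝ) :
    ∫ v, ⟪w v, z v⟫_ℝ ∂μ = ⟪mix w g, y⟫_ℝ := by
  rw [L2.inner_def]
  refine integral_congr_ae ?_
  filter_upwards [hz, coeFn_mix w g] with v h1 h2
  rw [h2, sum_inner, PiLp.inner_apply]
  refine Finset.sum_congr rfl fun j _ => ?_
  rw [inner_smul_left, h1]
  simp [mul_comm]

end Mix

/-! ### Pooling -/

section Pooling

variable {d : ℕ} {F : Type*} [NormedAddCommGroup F] [NormedSpace ℝ F]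

theorem memLp_gauss {s : ℝ} (hs : 0 < s) : MemLp (gauss d s) 2 volume := by
  have hc : 0 ≤ (s ^ d)⁻¹ * (2 * Real.pi) ^ (-(d : ℝ) / 2) := by positivity
  refine (memLp_two_iff_integrable_sq (continuous_gauss s).aestronglyMeasurable).2 ?_
  refine ((integrable_gauss (d := d) hs).const_mul
    ((s ^ d)⁻¹ * (2 * Real.pi) ^ (-(d : ℝ) / 2))).mono'
    ((continuous_gauss s).pow 2).aestronglyMeasurable (Filter.Eventually.of_forall fun u => ?_)
  have he : Real.exp (-‖s⁻¹ • u‖ ^ 2 / 2) ≤ 1 :=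
    Real.exp_le_one_iff.2 (by nlinarith [sq_nonneg ‖s⁻¹ • u‖])
  have hg : gauss d s u
      = (s ^ d)⁻¹ * (2 * Real.pi) ^ (-(d : ℝ) / 2) * Real.exp (-‖s⁻¹ • u‖ ^ 2 / 2) := by
    rw [gauss, mul_assoc]
  have hg0 : 0 ≤ gauss d s u := by rw [hg]; positivity
  rw [Real.norm_eq_abs, abs_of_nonneg (sq_nonneg _), sq]
  refine mul_le_mul_of_nonneg_right ?_ hg0
  rw [hg]
  exact mul_le_of_le_one_right hc he

/-- The Gaussian being square integrable, pooling of an `L²` map converges at every point. -/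
theorem integrable_gauss_smul {s : ℝ} (hs : 0 < s) {y : Dom d → F} (hy : MemLp y 2 volume)
    (u : Dom d) : Integrable fun v => gauss d s (u - v) • y v := by
  have h := (memLp_gauss (d := d) hs).comp_measurePreserving
    (Measure.measurePreserving_sub_left volume u)
  exact memLp_one_iff_integrable.1 (hy.smul h)

theorem pool_congr_ae {s : ℝ} {y y' : Dom d → F} (h : y =ᵐ[volume] y') : pool s y = pool s y' :=
  funext fun u => integral_congr_ae (h.mono fun v hv => by simp only [hv])

theorem memLp_pool_of_memLp {s : ℝ} (hs : 0 < s) {y : Dom d → F} (hy : MemLp y 2 volume) :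
    MemLp (pool s y) 2 volume := by
  rw [← pool_congr_ae hy.coeFn_toLp]
  exact memLp_pool hs _

theorem clm_pool {G : Type*} [NormedAddCommGroup G] [NormedSpace ℝ G] [CompleteSpace F]
    [CompleteSpace G] {s : ℝ} (hs : 0 < s) {y : Dom d → F} (hy : MemLp y 2 volume) (T : F →L[ℝ] G)
    (u : Dom d) : T (pool s y u) = pool s (fun v => T (y v)) u := by
  rw [pool, ← T.integral_comp_comm (integrable_gauss_smul hs hy u)]
  simp only [map_smul, pool]

end Pooling

/-! ### The induction over layers -/

theorem coeFn_patch {d : ℕ} {F : Type*} [NormedAddCommGroup F] (S : PatchShape d) (x : Signal d F)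
    (u : Dom d) : patch S x u =ᵐ[S.unif] fun v => x (u + v) :=
  (memLp_patch S x u).coeFn_toLp

section Layer

variable {d : ℕ} {F : Type*} [NormedAddCommGroup F] [InnerProductSpace ℝ F]

theorem memLp_featureMap_patch (l : Layer d) (x : Signal d F) :
    MemLp (fun u => featureMap l.coeffs (patch l.shape x u)) 2 volume :=
  (lipschitzWith_featureMap l.coeffs).comp_memLp (featureMap_zero l.coeffs)
    (memLp_patch_volume l.shape x)

theorem layerOp_ae_eq_pool (l : Layer d) (x : Signal d F) :
    layerOp l x =ᵐ[volume] pool l.scale fun u => featureMap l.coeffs (patch l.shape x u) := by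
  have h1 : kernelOp l.coeffs (patchOp l.shape x)
      =ᵐ[volume] fun u => featureMap l.coeffs (patch l.shape x u) := by
    refine ((lipschitzWith_featureMap l.coeffs).coeFn_compLp (featureMap_zero l.coeffs) _).trans ?_
    exact (memLp_patch_volume l.shape x).coeFn_toLp.fun_comp (featureMap l.coeffs)
  rw [← pool_congr_ae h1]
  exact (memLp_pool l.scale_pos _).coeFn_toLp

/-- A map whose channels are fixed linear functionals of `M P x` is square integrable, and the
channels of its pooling are the same functionals of `A M P x`. -/
theorem memLp_and_pool_eq_inner_layerOp (l : Layer d) {q : ℕ}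
    (g : Fin q → dotRKHS l.coeffs (Patch l.shape F)) (x : Signal d F)
    (y : Dom d → EuclideanSpace ℝ (Fin q))
    (hy : ∀ u i, y u i = ⟪g i, featureMap l.coeffs (patch l.shape x u)⟫_ℝ) :
    MemLp y 2 volume ∧ MemLp (pool l.scale y) 2 volume ∧
      ∀ᵐ u, ∀ i, pool l.scale y u i = ⟪g i, layerOp l x u⟫_ℝ := by
  have hx := memLp_featureMap_patch l x
  have hm : MemLp y 2 volume := MemLp.of_eval_piLp fun i => by
    simpa only [hy] using hx.const_inner (𝕜 := ℝ) (g i)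
  refine ⟨hm, memLp_pool_of_memLp l.scale_pos hm, ?_⟩
  filter_upwards [layerOp_ae_eq_pool l x] with u hu i
  have h1 := clm_pool l.scale_pos hm (EuclideanSpace.proj i : EuclideanSpace ℝ (Fin q) →L[ℝ] ℝ) u
  have h2 := clm_pool l.scale_pos hx (innerSL ℝ (g i)) u
  simp only [PiLp.proj_apply, innerSL_apply_apply] at h1 h2
  rw [hu, h1, h2]
  simp only [hy]

/-- An identity valid almost everywhere on `ℝ^d` holds almost everywhere on each patch. -/
theorem ae_unif_of_ae (S : PatchShape d) {P : Dom d → Prop} (h : ∀ᵐ v, P v) (u : Dom d) :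
    ∀ᵐ v ∂S.unif, P (u + v) :=
  (Measure.absolutelyContinuous_of_le_smul S.unif_le).ae_le
    ((measurePreserving_add_left volume u).quasiMeasurePreserving.ae h)

end Layer

section Induction

variable {d : ℕ} {n : ℕ} {L : ℕ → Layer d} {p : ℕ → ℕ} {σ : ℝ → ℝ} {a : ℕ → ℝ}

/-- One layer: once the filters of layer `k + 1` act on the CNN map `z_k` as elements `W i` of the
patch space act on `x_k`, the channels of `z_{k+1}` are linear functionals of `x_{k+1}`. -/
theorem exists_cnnMap_succ_eq_inner (hσ : ∀ u : ℝ, HasSum (fun j => a j * u ^ j) (σ u))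
    (w : Filters L p) (k : ℕ) (hab : ∀ j, (L k).coeffs.b j = 0 → a j = 0)
    (hC : ∀ t : ℝ, 0 ≤ t → Summable fun j => a j ^ 2 / (L k).coeffs.b j * t ^ j)
    (W : Fin (p (k + 1)) → Patch (L k).shape (featureSpace L (p 0) k))
    (hW : ∀ (x₀ : Signal d (EuclideanSpace ℝ (Fin (p 0)))) u i,
      ∫ v, ⟪w k i v, cnnMap L σ w x₀ k (u + v)⟫_ℝ ∂(L k).shape.unif
        = ⟪W i, patch (L k).shape (feature L x₀ k) u⟫_ℝ) :
    ∃ g : Fin (p (k + 1)) → featureSpace L (p 0) (k + 1),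
      (∀ i, ‖g i‖ ^ 2 ≤ actC a (L k).coeffs (‖W i‖ ^ 2)) ∧
      ∀ x₀ : Signal d (EuclideanSpace ℝ (Fin (p 0))),
        MemLp (cnnStep L σ w x₀ k (cnnMap L σ w x₀ k)) 2 volume ∧
        MemLp (cnnMap L σ w x₀ (k + 1)) 2 volume ∧
        ∀ᵐ u, ∀ i, cnnMap L σ w x₀ (k + 1) u i = ⟪g i, feature L x₀ (k + 1) u⟫_ℝ := by
  choose g hg hgz using fun i => exists_inner_featureMap_eq_activation (L k).coeffs hσ hab hC (W i)
  refine ⟨g, hg, fun x₀ => ?_⟩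
  refine memLp_and_pool_eq_inner_layerOp (L k) g (feature L x₀ k) _ fun u i => ?_
  rw [hgz, ← hW]
  rfl

/-- The channels of the CNN map `z_{k+1}` are linear functionals of the kernel representation
`x_{k+1}`, given by elements of `H_{k+1}` with squared norms at most `B_{k+1,i}`. -/
theorem exists_cnnMap_eq_inner (hσ : ∀ u : ℝ, HasSum (fun j => a j * u ^ j) (σ u))
    (hab : ∀ k < n, ∀ j, (L k).coeffs.b j = 0 → a j = 0)
    (hC : ∀ k < n, ∀ t : ℝ, 0 ≤ t → Summable fun j => a j ^ 2 / (L k).coeffs.b j * t ^ j)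
    (w : Filters L p) (k : ℕ) (hk : k < n) :
    ∃ g : Fin (p (k + 1)) → featureSpace L (p 0) (k + 1),
      (∀ i, ‖g i‖ ^ 2 ≤ bound L a w (k + 1) i) ∧
      ∀ x₀ : Signal d (EuclideanSpace ℝ (Fin (p 0))),
        MemLp (cnnStep L σ w x₀ k (cnnMap L σ w x₀ k)) 2 volume ∧
        MemLp (cnnMap L σ w x₀ (k + 1)) 2 volume ∧
        ∀ᵐ u, ∀ i, cnnMap L σ w x₀ (k + 1) u i = ⟪g i, feature L x₀ (k + 1) u⟫_ℝ := by
  induction k with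
  | zero =>
    -- `H_0` is the input space, so the filters of the first layer already act on `x_0`.
    refine exists_cnnMap_succ_eq_inner hσ w 0 (hab 0 hk) (hC 0 hk) (w 0) fun x₀ u i => ?_
    refine Eq.trans (integral_congr_ae ?_) (L2.inner_def (𝕜 := ℝ) (w 0 i) (patch _ x₀ u)).symm
    filter_upwards [coeFn_patch (L 0).shape x₀ u] with v hv
    rw [hv]
    rfl
  | succ k ih =>
    obtain ⟨g, hg, hgx⟩ := ih (k.lt_succ_self.trans hk)
    obtain ⟨g', hg', hgx'⟩ := exists_cnnMap_succ_eq_inner hσ w (k + 1) (hab _ hk) (hC _ hk)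
      (fun i => mix (w (k + 1) i) g) fun x₀ u i => by
        refine integral_inner_eq_inner_mix _ g _ (fun v => cnnMap L σ w x₀ (k + 1) (u + v)) ?_
        filter_upwards [ae_unif_of_ae (L (k + 1)).shape (hgx x₀).2.2 u,
          coeFn_patch (L (k + 1)).shape (feature L x₀ (k + 1)) u] with v h1 h2 j
        rw [h2]
        exact h1 j
    refine ⟨g', fun i => (hg' i).trans (actC_mono (hC _ hk) (sq_nonneg _) ?_), hgx'⟩
    refine (norm_mix_sq_le _ g).trans ?_
    gcongr with j
    exact hg j

end Induction

end CKN

theorem mainTheorem7 {d : ℕ} (n : ℕ) (hn : 1 ≤ n) (L : ℕ → CKN.Layer d) (p : ℕ → ℕ)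
    (σ : ℝ → ℝ) (a : ℕ → ℝ) (hσ : ∀ u : ℝ, HasSum (fun j => a j * u ^ j) (σ u))
    (hab : ∀ k < n, ∀ j, (L k).coeffs.b j = 0 → a j = 0)
    (hC : ∀ k < n, ∀ t : ℝ, 0 ≤ t → Summable fun j => a j ^ 2 / (L k).coeffs.b j * t ^ j)
    (w : CKN.Filters L p) (wOut : CKN.Signal d (EuclideanSpace ℝ (Fin (p n)))) :
    (∀ (x₀ : CKN.Signal d (EuclideanSpace ℝ (Fin (p 0)))), ∀ k < n,
      MemLp (CKN.cnnStep L σ w x₀ k (CKN.cnnMap L σ w x₀ k)) 2 volume ∧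
      MemLp (CKN.cnnMap L σ w x₀ (k + 1)) 2 volume) ∧
    ∃ f : CKN.finalRKHS L (p 0) n,
      (∀ x₀, f x₀ = CKN.cnn L σ w n wOut x₀) ∧
      ‖f‖ ^ 2 ≤ p n * ∑ i, ‖CKN.channel wOut i‖ ^ 2 * CKN.bound L a w n i := by
  refine ⟨fun x₀ k hk => ?_, ?_⟩
  · obtain ⟨g, -, hg⟩ := CKN.exists_cnnMap_eq_inner hσ hab hC w k hk
    exact ⟨(hg x₀).1, (hg x₀).2.1⟩
  · obtain ⟨m, rfl⟩ := Nat.exists_eq_add_of_le' hn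
    obtain ⟨g, hg, hgx⟩ := CKN.exists_cnnMap_eq_inner hσ hab hC w m m.lt_succ_self
    obtain ⟨f, hf, hfx⟩ := CKN.exists_inner_eq_of_gram_eq
      (fun x₀ => RKHS.kerFun (CKN.finalRKHS L (p 0) (m + 1)) x₀ (1 : ℝ))
      (fun x₀ => CKN.feature L x₀ (m + 1))
      (fun x y => by rw [CKN.inner_kerFun_one, CKN.finalKernel, real_inner_comm])
      (CKN.mix wOut g)
    refine ⟨f, fun x₀ => ?_, ?_⟩
    · have h1 := hfx x₀
      rw [RKHS.inner_kerFun] at h1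
      rw [CKN.cnn, CKN.integral_inner_eq_inner_mix wOut g _ _ (hgx x₀).2.2, ← h1]
      simp
    · refine (pow_le_pow_left₀ (norm_nonneg _) hf 2).trans ((CKN.norm_mix_sq_le wOut g).trans ?_)
      gcongr with i
      exact hg i
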